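/- Let $\mathbb{F}_q$ be the finite field with $q$ elements, let $n \ge 2$, and let $C \subset \mathbb{P}^n$ be a smooth space filling curve over $\mathbb{F}_q$. That is, $C = V(I)$ is the closed subscheme of $\mathbb{P}^n$ defined by a homogeneous ideal $I \subset \mathbb{F}_q[x_0, \dots, x_n]$ such that $C$ has dimension $1$, the base change of $C$ to $\overline{\mathbb{F}}_q$ is irreducible, $C$ is smooth (the Jacobian matrix of its defining equations has rank $n-1$ at every $\overline{\mathbb{F}}_q$-point of $C$), and $C$ passes through every rational point, i.e. $C(\mathbb{F}_q) = \mathbb{P}^n(\mathbb{F}_q)$. Then $$\deg C \ \ge\ \frac{q^n - 1}{q - 1} + 1,$$ where $\deg C$ is the leading coefficient of the Hilbert polynomial of $C$, i.e. the limit of $\frac{1}{m}\dim_{\mathbb{F}_q} \left(\mathbb{F}_q[x_0, \dots, x_n]/I\right)_m$ as $m \to \infty$. -/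

import Mathlib

open Filter MvPolynomial
open scoped LinearAlgebra.Projectivization

noncomputable section

attribute [instance] MvPolynomial.gradedAlgebra

/-- A closed subscheme of the projective space of dimension `n` over `k`, given by a homogeneous
ideal of `k[x_0, ..., x_n]` (by Hilbert's basis theorem, by finitely many homogeneous
polynomials). -/
abbrev ProjectiveSubscheme (k : Type*) [Field k] (n : ℕ) :=
  HomogeneousIdeal (homogeneousSubmodule (Fin (n + 1)) k)

namespace ProjectiveSubscheme

variable {k : Type*} [Field k] {n : ℕ}

/-- The defining homogeneous ideal of the base change to an extension `L` of `k`: the same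
polynomials, with coefficients read in `L`. -/
def baseChangeIdeal (C : ProjectiveSubscheme k n) (L : Type*) [Field L] [Algebra k L] :
    Ideal (MvPolynomial (Fin (n + 1)) L) :=
  C.toIdeal.map (MvPolynomial.map (algebraMap k L))

/-- The set of `L`-rational points. -/
def points (C : ProjectiveSubscheme k n) (L : Type*) [Field L] [Algebra k L] :
    Set (ℙ L (Fin (n + 1) → L)) :=
  {p | ∀ f ∈ C.toIdeal, aeval p.rep f = 0}

/-- The underlying topological space of the subscheme, as a subset of `Proj k[x_0, ..., x_n]`. -/
def carrier (C : ProjectiveSubscheme k n) :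
    Set (ProjectiveSpectrum (homogeneousSubmodule (Fin (n + 1)) k)) :=
  ProjectiveSpectrum.zeroLocus _ (C.toIdeal : Set (MvPolynomial (Fin (n + 1)) k))

/-- The subscheme has dimension `d`. -/
def HasDim (C : ProjectiveSubscheme k n) (d : ℕ) : Prop :=
  topologicalKrullDim C.carrier = d

/-- The base change to the algebraic closure of `k` is irreducible (in particular nonempty). -/
def GeometricallyIrreducible (C : ProjectiveSubscheme k n) : Prop :=
  IsIrreducible (ProjectiveSpectrum.zeroLocus
    (homogeneousSubmodule (Fin (n + 1)) (AlgebraicClosure k))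
    (C.baseChangeIdeal (AlgebraicClosure k) :
      Set (MvPolynomial (Fin (n + 1)) (AlgebraicClosure k))))

/-- The rank of the Jacobian matrix of the defining equations at the point with homogeneous
coordinates `v`: the dimension of the span of the gradients. It suffices to let `f` run through
homogeneous generators. By Euler's relation the gradients at a zero `v` are orthogonal to `v`, so
this is also the rank of the Jacobian matrix of the local equations in any standard affine chart
around the point. -/
def jacobianRank (C : ProjectiveSubscheme k n) {L : Type*} [Field L] [Algebra k L]
    (v : Fin (n + 1) → L) : ℕ :=
  Module.finrank L (Submodule.span L
    {w : Fin (n + 1) → L | ∃ f ∈ C.toIdeal, w = fun j => aeval v (pderiv j f)})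

/-- Smoothness of a subscheme of dimension `d`: the Jacobian matrix has rank `n - d` at every
geometric point. -/
def IsSmoothOfDim (C : ProjectiveSubscheme k n) (d : ℕ) : Prop :=
  ∀ p ∈ C.points (AlgebraicClosure k), C.jacobianRank p.rep + d = n

/-- The Hilbert function: the dimension over `k` of the degree `m` part of the homogeneous
coordinate ring `k[x_0, ..., x_n] / I`. -/
def hilbertFunction (C : ProjectiveSubscheme k n) (m : ℕ) : ℕ :=
  Module.finrank k ((homogeneousSubmodule (Fin (n + 1)) k m).map
    (Ideal.Quotient.mkₐ k C.toIdeal).toLinearMap)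

/-- The degree of a subscheme of dimension `d`: `d !` times the leading coefficient of its Hilbert
polynomial, that is, the limit of `d ! * h m / m ^ d`, where `h` is the Hilbert function
(see `degree_eq_of_hilbertPolynomial`). -/
def degree (C : ProjectiveSubscheme k n) (d : ℕ) : EReal :=
  limsup (fun m : ℕ =>
    (((Nat.factorial d : ℝ) * (C.hilbertFunction m : ℝ) / (m : ℝ) ^ d : ℝ) : EReal)) atTop

/-- If the Hilbert function agrees in large degrees with a polynomial `P` of degree `d`, then the
degree is `d !` times the leading coefficient of `P`. -/
theorem degree_eq_of_hilbertPolynomial (C : ProjectiveSubscheme k n) (d : ℕ) (P : Polynomial ℝ)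
    (hd : P.degree = d) (hP : ∀ᶠ m : ℕ in atTop, (C.hilbertFunction m : ℝ) = P.eval (m : ℝ)) :
    C.degree d = (((Nat.factorial d : ℝ) * P.leadingCoeff : ℝ) : EReal) := by
  refine Tendsto.limsup_eq ?_
  refine (continuous_coe_real_ereal.tendsto _).comp ?_
  have h1 := Polynomial.div_tendsto_atTop_leadingCoeff_div_of_degree_eq P (Polynomial.X ^ d)
    (by rw [hd, Polynomial.degree_X_pow])
  have h2 := (h1.comp tendsto_natCast_atTop_atTop).const_mul (Nat.factorial d : ℝ)
  simp only [Polynomial.leadingCoeff_X_pow, div_one] at h2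
  refine h2.congr' ?_
  filter_upwards [hP] with m hm
  simp [hm, mul_div_assoc]

/-- Space filling curves over `k`: geometrically irreducible of dimension one, containing every
`k`-rational point of the projective space. -/
structure IsSpaceFillingCurve (C : ProjectiveSubscheme k n) : Prop where
  hasDim : C.HasDim 1
  geometricallyIrreducible : C.GeometricallyIrreducible
  points_eq : C.points k = Set.univ

/-- Smooth space filling curves over `k`. -/
structure IsSmoothSpaceFillingCurve (C : ProjectiveSubscheme k n) : Prop
    extends C.IsSpaceFillingCurve where
  smooth : C.IsSmoothOfDim 1

end ProjectiveSubscheme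

end

/-! The forms over `k` vanishing on the curve generate a prime ideal `J` that vanishes at every
rational point (`exists_isPrime`). At P = [1:0:…:0] the curve has a tangent direction `u`: otherwise
Nakayama's lemma would reduce V(J) to P, although it contains other rational points
(`exists_tangent_vector`). As n ≥ 2, some rational hyperplane ℓ = 0 contains both P and `u`. It
meets the curve in each of its own (q^n - 1)/(q - 1) rational points, with multiplicity at least 2
at P, so the bound is an instance of Bézout.

Bézout is replaced by a count of dimensions. Since ℓ is not in the prime `J`, multiplication by ℓ is
injective on S/J. The values at the rational points of the hyperplane and the derivative at P along
`u` are linear functionals that kill `J` and ℓS, and in large degrees they are independent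
(`map_homogeneousSubmodule_eq_top`). Hence each step in degree raises the Hilbert function of S/J by
at least (q^n - 1)/(q - 1) + 1 (`finrank_quotientPart_add_le`). The Hilbert function of the curve
dominates that of S/J. -/

/-! ### Local algebra: Taylor expansion and Nakayama's lemma -/

/-- First order Taylor expansion of a polynomial. -/
theorem MvPolynomial.aeval_add_sub_mem_sq {σ R A : Type*} [Fintype σ] [CommRing R] [CommRing A]
    [Algebra R A] (M : Ideal A) (a b : σ → A) (hb : ∀ i, b i ∈ M) (f : MvPolynomial σ R) :
    aeval (a + b) f - (aeval a f + ∑ j, aeval a (pderiv j f) * b j) ∈ M ^ 2 := by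
  classical
  induction f using MvPolynomial.induction_on with
  | C r => simp
  | add p q hp hq =>
    convert add_mem hp hq using 1
    simp only [map_add, add_mul, Finset.sum_add_distrib]
    ring
  | mul_X p i hp =>
    have h1 : ∑ j, aeval a (pderiv j p) * b j ∈ M :=
      Ideal.sum_mem _ fun j _ => M.mul_mem_left _ (hb j)
    have h2 : b i * ∑ j, aeval a (pderiv j p) * b j ∈ M ^ 2 := by
      rw [pow_two]; exact Ideal.mul_mem_mul (hb i) h1
    convert add_mem (Ideal.mul_mem_left _ (a i + b i) hp) h2 using 1
    have h3 : ∑ j, aeval a (pderiv j (p * X i)) * b j =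
        a i * ∑ j, aeval a (pderiv j p) * b j + aeval a p * b i := by
      simp only [Derivation.leibniz, pderiv_X, smul_eq_mul, map_add, map_mul, aeval_X, add_mul,
        Finset.sum_add_distrib, Finset.mul_sum]
      rw [add_comm]
      congr 1
      · exact Finset.sum_congr rfl fun j _ => by ring
      · rw [Finset.sum_eq_single i]
        · simp
        · intro j _ hj; simp [hj.symm]
        · simp
    rw [h3]
    simp only [map_mul, aeval_X, Pi.add_apply]
    ring

/-- A version of Nakayama's lemma modulo a prime ideal at a point of its zero locus. -/
theorem Ideal.IsPrime.mem_of_mul_mem_sup_span_sq {R K ι : Type*} [CommRing R] [CommRing K]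
    [Nontrivial K] [Fintype ι] {J : Ideal R} (hJ : J.IsPrime) (φ : R →+* K)
    (hφJ : ∀ f ∈ J, φ f = 0) (x a : ι → R) (hx : ∀ i, φ (x i) = 0) (ha : ∀ i, φ (a i) = 1)
    (h : ∀ i, a i * x i ∈ J ⊔ Ideal.span (Set.range x) ^ 2) (i : ι) : x i ∈ J := by
  classical
  have key : ∀ i, ∃ b : ι → R, (∀ j, φ (b j) = 0) ∧ a i * x i - ∑ j, b j * x j ∈ J := by
    intro i
    obtain ⟨f, hf, g, hg, hfg⟩ := Submodule.mem_sup.1 (h i)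
    rw [pow_two, ← smul_eq_mul, Submodule.mem_ideal_smul_span_iff_exists_sum] at hg
    obtain ⟨b, hb, rfl⟩ := hg
    refine ⟨b, fun j => ?_, ?_⟩
    · have hle : Ideal.span (Set.range x) ≤ RingHom.ker φ := by
        rw [Ideal.span_le]
        rintro _ ⟨i, rfl⟩
        exact hx i
      exact hle (hb j)
    · rw [← hfg, Finsupp.sum_fintype _ _ (by simp)]
      simpa using hf
  choose b hb hbJ using key
  -- Determinant trick: `A` sends `x` into `J`, so `det A * x i ∈ J`. As `φ` maps `A` to the
  -- identity and kills `J`, `det A` is not in `J`.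
  set A : Matrix ι ι R := Matrix.diagonal a - Matrix.of b with hA
  have hAx : ∀ i, (A.mulVec x) i ∈ J := fun i => by
    have : (A.mulVec x) i = a i * x i - ∑ j, b i j * x j := by
      rw [hA, Matrix.sub_mulVec, Pi.sub_apply, Matrix.mulVec_diagonal]
      rfl
    rw [this]; exact hbJ i
  have hdet : A.det * x i ∈ J := by
    have : A.det * x i = (A.adjugate.mulVec (A.mulVec x)) i := by
      rw [Matrix.mulVec_mulVec, Matrix.adjugate_mul, Matrix.smul_mulVec, Matrix.one_mulVec]
      rfl
    rw [this]
    exact Ideal.sum_mem _ fun j _ => J.mul_mem_left _ (hAx j)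
  refine (hJ.mem_or_mem hdet).resolve_left fun hd => ?_
  have h1 : φ A.det = 1 := by
    rw [RingHom.map_det]
    have : φ.mapMatrix A = 1 := by
      ext i j
      simp [hA, Matrix.diagonal_apply, Matrix.one_apply, hb]
      split_ifs with h <;> simp [ha]
    rw [this, Matrix.det_one]
  exact zero_ne_one ((hφJ _ hd).symm.trans h1)

/-! ### Directional derivatives and the tangent vector -/

/-- A form of degree `d` scales by `t ^ d` when its arguments are multiplied by `t`. -/
theorem MvPolynomial.IsHomogeneous.aeval_const_mul {σ R A : Type*} [CommSemiring R] [CommSemiring A]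
    [Algebra R A] {f : MvPolynomial σ R} {d : ℕ} (hf : f.IsHomogeneous d) (t : A) (v : σ → A) :
    MvPolynomial.aeval (fun i => t * v i) f = t ^ d * MvPolynomial.aeval v f := by
  rw [aeval_def, aeval_def, eval₂_eq, eval₂_eq, Finset.mul_sum]
  refine Finset.sum_congr rfl fun m hm => ?_
  rw [hf.degree_eq_sum_deg_support hm]
  simp only [mul_pow, Finset.prod_mul_distrib, Finset.prod_pow_eq_pow_sum]
  ring

/-- The derivative at `v` in the direction `u`. -/
noncomputable def MvPolynomial.dirDeriv {σ k : Type*} [Fintype σ] [CommRing k] (v u : σ → k) :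
    MvPolynomial σ k →ₗ[k] k :=
  ∑ j, u j • (aeval v).toLinearMap ∘ₗ (pderiv j).toLinearMap

theorem MvPolynomial.dirDeriv_apply {σ k : Type*} [Fintype σ] [CommRing k] (v u : σ → k)
    (f : MvPolynomial σ k) : dirDeriv v u f = ∑ j, u j * aeval v (pderiv j f) := by
  simp [dirDeriv]

theorem MvPolynomial.dirDeriv_mul {σ k : Type*} [Fintype σ] [CommRing k] (v u : σ → k)
    (f g : MvPolynomial σ k) :
    dirDeriv v u (f * g) = aeval v f * dirDeriv v u g + aeval v g * dirDeriv v u f := by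
  simp only [dirDeriv_apply, Finset.mul_sum, ← Finset.sum_add_distrib]
  refine Finset.sum_congr rfl fun j _ => ?_
  simp only [Derivation.leibniz, smul_eq_mul, map_add, map_mul]
  ring

theorem MvPolynomial.aeval_aeval_C {σ R A : Type*} [CommSemiring R] [CommSemiring A]
    [Algebra R A] (v : σ → R) (f : MvPolynomial σ R) :
    aeval (fun i => algebraMap R A (v i)) f = algebraMap R A (aeval v f) := by
  simpa [Function.comp_def] using aeval_algebraMap_apply A v f

theorem LinearMap.sum_apply_single_mul {σ k : Type*} [Fintype σ] [DecidableEq σ] [CommRing k]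
    (φ : (σ → k) →ₗ[k] k) (v : σ → k) : ∑ i, φ (Pi.single i 1) * v i = φ v := by
  rw [LinearMap.pi_apply_eq_sum_univ φ v]
  refine Finset.sum_congr rfl fun j _ => ?_
  rw [smul_eq_mul, mul_comm]
  congr 2
  funext l
  simp [Pi.single_apply, eq_comm]

/-- A homogeneous prime ideal vanishing at all points of a projective space of positive dimension
has a nonzero tangent vector at the first coordinate point. -/
theorem MvPolynomial.exists_tangent_vector {k : Type*} [Field k] {n : ℕ} (hn : 1 ≤ n)
    {J : Ideal (MvPolynomial (Fin (n + 1)) k)} (hJ : J.IsPrime)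
    (hhom : ∀ f ∈ J, ∀ d, homogeneousComponent d f ∈ J)
    (hpt : ∀ v : Fin (n + 1) → k, v ≠ 0 → ∀ f ∈ J, aeval v f = 0) :
    ∃ u : Fin (n + 1) → k, (∃ i, i ≠ 0 ∧ u i ≠ 0) ∧
      ∀ f ∈ J, dirDeriv (Pi.single 0 1) u f = 0 := by
  classical
  set P : Fin (n + 1) → k := Pi.single 0 1 with hP
  have hP0 : P ≠ 0 := fun h => by simpa [hP] using congrFun h 0
  -- The `y i` generate the ideal of `P`; the entry at 0 is set to 0 so that `X = X 0 • P + y`.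
  set y : Fin (n + 1) → MvPolynomial (Fin (n + 1)) k := Function.update X 0 0 with hy
  set M := Ideal.span (Set.range y) with hM
  -- Linear forms that die in the cotangent space of V(J) at `P`; the power of `X 0` stands in for
  -- localization at `P`.
  let W : Submodule k (Fin (n + 1) → k) :=
    { carrier := {w | ∃ e : ℕ, X 0 ^ e * ∑ j, C (w j) * y j ∈ J ⊔ M ^ 2}
      zero_mem' := ⟨0, by simp⟩
      add_mem' := by
        rintro w w' ⟨e, he⟩ ⟨e', he'⟩
        refine ⟨e + e', ?_⟩
        convert add_mem (Ideal.mul_mem_left _ (X 0 ^ e') he) (Ideal.mul_mem_left _ (X 0 ^ e) he')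
          using 1
        simp only [Pi.add_apply, map_add, add_mul, Finset.sum_add_distrib]
        ring
      smul_mem' := by
        rintro c w ⟨e, he⟩
        refine ⟨e, ?_⟩
        convert Ideal.mul_mem_left _ (C c) he using 1
        simp only [Pi.smul_apply, smul_eq_mul, map_mul, mul_assoc, ← Finset.mul_sum]
        ring }
  have hgrad : ∀ f ∈ J, ∀ d, f.IsHomogeneous d → (fun j => aeval P (pderiv j f)) ∈ W := by
    intro f hf d hd
    refine ⟨d - 1, ?_⟩
    have ht := aeval_add_sub_mem_sq M (fun i => X 0 * C (P i)) y
      (fun i => Ideal.subset_span ⟨i, rfl⟩) f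
    have hX : ((fun i => X 0 * C (P i)) + y : Fin (n + 1) → MvPolynomial (Fin (n + 1)) k) = X := by
      funext i
      by_cases hi : i = 0
      · subst hi; simp [hP, hy]
      · simp [hP, hy, hi]
    have hev : ∀ (g : MvPolynomial (Fin (n + 1)) k) (e : ℕ), g.IsHomogeneous e →
        aeval (fun i => X 0 * C (P i) : Fin (n + 1) → MvPolynomial (Fin (n + 1)) k) g =
          X 0 ^ e * C (aeval P g) := by
      intro g e hg
      rw [hg.aeval_const_mul]
      congr 1
      exact aeval_aeval_C P g
    rw [hX, hev f d hd, hpt P hP0 f hf, aeval_X_left_apply] at ht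
    have hs : ∑ j, aeval (fun i => X 0 * C (P i) : Fin (n + 1) → MvPolynomial (Fin (n + 1)) k)
        (pderiv j f) * y j = X 0 ^ (d - 1) * ∑ j, C (aeval P (pderiv j f)) * y j := by
      rw [Finset.mul_sum]
      refine Finset.sum_congr rfl fun j _ => ?_
      rw [hev _ _ hd.pderiv, mul_assoc]
    rw [hs] at ht
    simp only [map_zero, mul_zero, zero_add] at ht
    have h1 := Ideal.mem_sup_left (T := M ^ 2) hf
    have h2 := Ideal.mem_sup_right (S := J) ht
    simpa using sub_mem h1 h2
  have hex : ∃ i : Fin (n + 1), i ≠ 0 ∧ Pi.single i 1 ∉ W := by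
    by_contra! hall
    have hall' : ∀ i, ∃ e : ℕ, X 0 ^ e * y i ∈ J ⊔ M ^ 2 := by
      intro i
      by_cases hi : i = 0
      · exact ⟨0, by simp [hi, hy]⟩
      · obtain ⟨e, he⟩ := hall i hi
        refine ⟨e, ?_⟩
        convert he using 2
        rw [Finset.sum_eq_single i] <;> simp +contextual
    choose e he using hall'
    have hyJ := hJ.mem_of_mul_mem_sup_span_sq (aeval P : _ →ₐ[k] k).toRingHom (hpt P hP0) y
      (fun i => X 0 ^ e i) (fun i => by
        by_cases hi : i = 0
        · simp [hi, hy]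
        · simp [hi, hy, hP]) (fun i => by simp [hP]) he
    obtain ⟨i, hi⟩ : ∃ i : Fin (n + 1), i ≠ 0 := ⟨Fin.last n, by
      rw [Ne, Fin.ext_iff]; simp; omega⟩
    -- With all `y i` in `J`, the locus of `J` would miss the `i`-th coordinate point.
    have h1 := hpt (Pi.single i 1) (fun h => by simpa using congrFun h i) _ (hyJ i)
    simp [hy, hi] at h1
  obtain ⟨i, hi, hiW⟩ := hex
  -- A functional killing `W` kills the gradients at `P` of all forms in `J`, so its coordinates
  -- form a tangent vector.
  obtain ⟨φ, hφ, hW⟩ := Submodule.exists_le_ker_of_notMem hiW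
  refine ⟨fun j => φ (Pi.single j 1), ⟨i, hi, hφ⟩, fun f hf => ?_⟩
  rw [← sum_homogeneousComponent f, map_sum]
  refine Finset.sum_eq_zero fun d _ => ?_
  rw [dirDeriv_apply, φ.sum_apply_single_mul fun j => aeval P (pderiv j (homogeneousComponent d f))]
  exact hW (hgrad _ (hhom f hf d) d (homogeneousComponent_isHomogeneous d f))

/-! ### Points of Proj and the prime ideal of the curve -/

theorem MvPolynomial.homogeneousComponent_map {σ R S : Type*} [CommSemiring R] [CommSemiring S]
    (g : R →+* S) (d : ℕ) (f : MvPolynomial σ R) :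
    homogeneousComponent d (MvPolynomial.map g f) =
      MvPolynomial.map g (homogeneousComponent d f) := by
  ext m
  simp only [coeff_homogeneousComponent, coeff_map]
  split_ifs <;> simp

/-- Restriction of polynomial functions to the line through `v`. -/
noncomputable def MvPolynomial.restrictLine {σ K : Type*} [CommRing K] (v : σ → K) :
    MvPolynomial σ K →ₐ[K] Polynomial K :=
  aeval fun i => Polynomial.X * Polynomial.C (v i)

/-- On the line through `v`, a form of degree `d` becomes `T ^ d` times its value at `v`. So the
kernel of the restriction is the homogeneous ideal of the point, prime because `K[T]` is a domain.
-/
theorem MvPolynomial.coeff_restrictLine {σ K : Type*} [CommRing K] (v : σ → K)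
    (f : MvPolynomial σ K) (d : ℕ) :
    (restrictLine v f).coeff d = aeval v (homogeneousComponent d f) := by
  have h : ∀ e, restrictLine v (homogeneousComponent e f) =
      Polynomial.X ^ e * Polynomial.C (aeval v (homogeneousComponent e f)) := fun e => by
    rw [restrictLine, (homogeneousComponent_isHomogeneous e f).aeval_const_mul]
    congr 1
    exact aeval_aeval_C v _
  conv_lhs => rw [← sum_homogeneousComponent f, map_sum]
  simp only [h, Polynomial.finsetSum_coeff, Polynomial.coeff_X_pow_mul', Polynomial.coeff_C]
  by_cases hd : d < f.totalDegree + 1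
  · rw [Finset.sum_eq_single d]
    · simp
    · intro e _ he
      split_ifs <;> first | rfl | omega
    · simp; omega
  · rw [homogeneousComponent_eq_zero _ _ (by omega), map_zero]
    refine Finset.sum_eq_zero fun e he => ?_
    rw [Finset.mem_range] at he
    split_ifs <;> first | rfl | omega

theorem MvPolynomial.coe_decompose_homogeneousSubmodule {σ R : Type*} [CommSemiring R]
    (f : MvPolynomial σ R) (d : ℕ) :
    (DirectSum.decompose (homogeneousSubmodule σ R) f d : MvPolynomial σ R) =
      homogeneousComponent d f :=
  decomposition.decompose'_apply f d

/-- The point of `Proj` with homogeneous coordinates `v`. -/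
noncomputable def ProjectiveSpectrum.ofCoordinates {σ K : Type*} [Field K] (v : σ → K)
    (hv : v ≠ 0) : ProjectiveSpectrum (homogeneousSubmodule σ K) where
  asHomogeneousIdeal := ⟨RingHom.ker (restrictLine v), by
    intro d f hf
    rw [coe_decompose_homogeneousSubmodule]
    rw [RingHom.mem_ker] at hf ⊢
    ext e
    rw [coeff_restrictLine, homogeneousComponent_of_mem (homogeneousComponent_mem d f)]
    split_ifs with h
    · rw [← coeff_restrictLine, hf, Polynomial.coeff_zero, Polynomial.coeff_zero]
    · simp⟩
  isPrime := RingHom.ker_isPrime _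
  not_irrelevant_le := by
    intro h
    obtain ⟨i, hi⟩ := Function.ne_iff.1 hv
    have h1 : (X i : MvPolynomial σ K) ∈
        HomogeneousIdeal.irrelevant (homogeneousSubmodule σ K) := by
      rw [HomogeneousIdeal.mem_irrelevant_iff, GradedRing.proj_apply]
      rw [coe_decompose_homogeneousSubmodule, homogeneousComponent_of_mem
        ((mem_homogeneousSubmodule _ _).2 (isHomogeneous_X K i))]
      simp
    have h2 : restrictLine v (X i) = 0 := h h1
    have h3 := congrArg (fun p => Polynomial.coeff p 1) h2
    simp [restrictLine] at h3
    exact hi h3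

theorem ProjectiveSpectrum.mem_ofCoordinates {σ K : Type*} [Field K] {v : σ → K}
    (hv : v ≠ 0) {f : MvPolynomial σ K} :
    f ∈ (ofCoordinates v hv).asHomogeneousIdeal.toIdeal ↔
      ∀ d, aeval v (homogeneousComponent d f) = 0 := by
  change restrictLine v f = 0 ↔ _
  simp only [Polynomial.ext_iff, coeff_restrictLine, Polynomial.coeff_zero]

/-- The vanishing ideal of an irreducible subset of `Proj` is prime. -/
theorem ProjectiveSpectrum.isPrime_vanishingIdeal {A σ : Type*} [CommRing A] [SetLike σ A]
    [AddSubmonoidClass σ A] {𝒜 : ℕ → σ} [GradedRing 𝒜] {Z : Set (ProjectiveSpectrum 𝒜)}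
    (hZ : IsIrreducible Z) : (vanishingIdeal Z).toIdeal.IsPrime := by
  refine (vanishingIdeal Z).isHomogeneous.isPrime_of_homogeneous_mem_or_mem ?_ ?_
  · obtain ⟨x, hx⟩ := hZ.nonempty
    intro h
    refine x.isPrime.ne_top ((Ideal.eq_top_iff_one _).2 ?_)
    exact (mem_vanishingIdeal Z 1).1 ((Ideal.eq_top_iff_one _).1 h) x hx
  · intro f g _ _ hfg
    have hcov : Z ⊆ zeroLocus 𝒜 {f} ∪ zeroLocus 𝒜 {g} := by
      rw [← zeroLocus_singleton_mul]
      intro x hx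
      simpa using (mem_vanishingIdeal Z _).1 hfg x hx
    have h := (isPreirreducible_iff_isClosed_union_isClosed.1 hZ.isPreirreducible) _ _
      (isClosed_zeroLocus 𝒜 {f}) (isClosed_zeroLocus 𝒜 {g}) hcov
    refine h.imp (fun h => ?_) (fun h => ?_)
    · exact (mem_vanishingIdeal Z _).2 fun x hx => by simpa using h hx
    · exact (mem_vanishingIdeal Z _).2 fun x hx => by simpa using h hx

namespace ProjectiveSubscheme

variable {k : Type*} [Field k] {n : ℕ}

theorem homogeneousComponent_mem (C : ProjectiveSubscheme k n) {f : MvPolynomial (Fin (n + 1)) k}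
    (hf : f ∈ C.toIdeal) (d : ℕ) : homogeneousComponent d f ∈ C.toIdeal :=
  homogeneousComponent_mem_of_mem C.isHomogeneous hf d

theorem aeval_homogeneousComponent_eq_zero {C : ProjectiveSubscheme k n}
    (hC : C.points k = Set.univ) {v : Fin (n + 1) → k} (hv : v ≠ 0)
    {f : MvPolynomial (Fin (n + 1)) k} (hf : f ∈ C.toIdeal) (d : ℕ) :
    aeval v (homogeneousComponent d f) = 0 := by
  have h : Projectivization.mk k v hv ∈ C.points k := hC ▸ Set.mem_univ _
  obtain ⟨a, ha⟩ := Projectivization.exists_smul_eq_mk_rep k v hv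
  have h1 := h _ (C.homogeneousComponent_mem hf d)
  rw [← ha] at h1
  have h2 := (homogeneousComponent_isHomogeneous d f).aeval_const_mul (a : k) v
  rw [show (fun i => (a : k) * v i) = a • v from rfl, h1] at h2
  exact (mul_eq_zero.1 h2.symm).resolve_left (pow_ne_zero _ a.ne_zero)

/-- A geometrically irreducible subscheme containing all rational points contains an integral
closed subscheme with the same rational points. -/
theorem exists_isPrime {C : ProjectiveSubscheme k n} (hirr : C.GeometricallyIrreducible)
    (hC : C.points k = Set.univ) :
    ∃ J : Ideal (MvPolynomial (Fin (n + 1)) k), J.IsPrime ∧ C.toIdeal ≤ J ∧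
      (∀ f ∈ J, ∀ d, homogeneousComponent d f ∈ J) ∧
      ∀ v : Fin (n + 1) → k, v ≠ 0 → ∀ f ∈ J, aeval v f = 0 := by
  set K := AlgebraicClosure k
  set V := ProjectiveSpectrum.vanishingIdeal (ProjectiveSpectrum.zeroLocus
    (homogeneousSubmodule (Fin (n + 1)) K)
    (C.baseChangeIdeal K : Set (MvPolynomial (Fin (n + 1)) K))) with hV
  have hprime : V.toIdeal.IsPrime := ProjectiveSpectrum.isPrime_vanishingIdeal hirr
  have hle := ProjectiveSpectrum.ideal_le_vanishingIdeal_zeroLocus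
    (homogeneousSubmodule (Fin (n + 1)) K) (C.baseChangeIdeal K)
  -- Primality holds over the algebraic closure and descends to `k` by contraction.
  refine ⟨V.toIdeal.comap (MvPolynomial.map (algebraMap k K)), hprime.comap _, ?_, ?_, ?_⟩
  · intro f hf
    exact hle (Ideal.mem_map_of_mem _ hf)
  · intro f hf d
    rw [Ideal.mem_comap, ← homogeneousComponent_map]
    exact homogeneousComponent_mem_of_mem V.isHomogeneous hf d
  · intro v hv f hf
    set w : Fin (n + 1) → K := fun i => algebraMap k K (v i) with hw
    have hw0 : w ≠ 0 := fun h => hv (funext fun i =>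
      (algebraMap k K).injective (by simpa [hw] using congrFun h i))
    have hev : ∀ g : MvPolynomial (Fin (n + 1)) k,
        aeval w (MvPolynomial.map (algebraMap k K) g) = algebraMap k K (aeval v g) := fun g => by
      rw [aeval_map_algebraMap, hw, aeval_aeval_C]
    have hmem : ProjectiveSpectrum.ofCoordinates w hw0 ∈ ProjectiveSpectrum.zeroLocus
        (homogeneousSubmodule (Fin (n + 1)) K)
        (C.baseChangeIdeal K : Set (MvPolynomial (Fin (n + 1)) K)) := by
      rw [ProjectiveSpectrum.mem_zeroLocus]
      change C.baseChangeIdeal K ≤ (ProjectiveSpectrum.ofCoordinates w hw0).asHomogeneousIdeal.toIdeal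
      refine Ideal.map_le_iff_le_comap.2 fun g hg => ?_
      rw [Ideal.mem_comap, ProjectiveSpectrum.mem_ofCoordinates]
      intro d
      rw [homogeneousComponent_map, hev, aeval_homogeneousComponent_eq_zero hC hv hg, map_zero]
    have h1 := (ProjectiveSpectrum.mem_vanishingIdeal _ _).1 hf _ hmem
    have h2 := (ProjectiveSpectrum.mem_ofCoordinates hw0).1 h1
    refine (algebraMap k K).injective ?_
    rw [← hev, map_zero, ← sum_homogeneousComponent (MvPolynomial.map (algebraMap k K) f),
      map_sum]
    exact Finset.sum_eq_zero fun d _ => h2 d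

end ProjectiveSubscheme

/-! ### Forms separating points and a tangent vector -/

namespace MvPolynomial

variable {σ k : Type*} [Fintype σ] [DecidableEq σ] [Field k]

/-- The linear form attached to a linear functional. -/
noncomputable def ofDual (φ : (σ → k) →ₗ[k] k) : MvPolynomial σ k :=
  ∑ i, C (φ (Pi.single i 1)) * X i

theorem isHomogeneous_ofDual (φ : (σ → k) →ₗ[k] k) : (ofDual φ).IsHomogeneous 1 :=
  IsHomogeneous.sum _ _ _ fun i _ => isHomogeneous_C_mul_X _ i

theorem aeval_ofDual (φ : (σ → k) →ₗ[k] k) (v : σ → k) : aeval v (ofDual φ) = φ v := by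
  simp [ofDual, ← LinearMap.sum_apply_single_mul φ v]

theorem dirDeriv_ofDual (φ : (σ → k) →ₗ[k] k) (v u : σ → k) :
    dirDeriv v u (ofDual φ) = φ u := by
  rw [dirDeriv_apply, ← LinearMap.sum_apply_single_mul φ u]
  refine Finset.sum_congr rfl fun j _ => ?_
  rw [mul_comm]
  congr 1
  simp only [ofDual, map_sum, Derivation.leibniz, pderiv_X, pderiv_C, smul_eq_mul, mul_zero,
    add_zero, map_mul]
  rw [Finset.sum_eq_single j]
  · simp
  · intro i _ hi; simp [hi]
  · simp

variable {ι : Type*} [Fintype ι] [DecidableEq ι]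

/-- A product of linear forms, one through each other point and avoiding `Q i`. -/
theorem exists_separating_form {Q : ι → σ → k}
    (hQ : ∀ i j, i ≠ j → Q i ∉ Submodule.span k {Q j}) (i : ι) :
    ∃ g : MvPolynomial σ k, g.IsHomogeneous (Fintype.card ι - 1) ∧ aeval (Q i) g ≠ 0 ∧
      ∀ j, j ≠ i → aeval (Q j) g = 0 := by
  have h : ∀ j, ∃ φ : (σ → k) →ₗ[k] k, j ≠ i → φ (Q i) ≠ 0 ∧ φ (Q j) = 0 := fun j => by
    by_cases hj : j = i
    · exact ⟨0, fun h => absurd hj h⟩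
    · obtain ⟨φ, h1, h2⟩ := Submodule.exists_le_ker_of_notMem (hQ i j (Ne.symm hj))
      exact ⟨φ, fun _ => ⟨h1, h2 (Submodule.mem_span_singleton_self _)⟩⟩
  choose φ hφ using h
  refine ⟨∏ j ∈ Finset.univ.erase i, ofDual (φ j), ?_, ?_, ?_⟩
  · convert IsHomogeneous.prod (Finset.univ.erase i) (fun j => ofDual (φ j)) (fun _ => 1)
      (fun j _ => isHomogeneous_ofDual _) using 1
    simp [Finset.card_erase_of_mem]
  · rw [map_prod, Finset.prod_ne_zero_iff]
    intro j hj
    rw [aeval_ofDual]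
    exact (hφ j (Finset.ne_of_mem_erase hj)).1
  · intro j hj
    rw [map_prod]
    refine Finset.prod_eq_zero (Finset.mem_erase.2 ⟨hj, Finset.mem_univ j⟩) ?_
    rw [aeval_ofDual]
    exact (hφ j hj).2

/-- Forms of a large degree separate finitely many points and a tangent vector at one of them. -/
theorem map_homogeneousSubmodule_eq_top {Q : ι → σ → k} (hQ0 : ∀ i, Q i ≠ 0)
    (hQ : ∀ i j, i ≠ j → Q i ∉ Submodule.span k {Q j}) (i₀ : ι) {u : σ → k}
    (hu : u ∉ Submodule.span k {Q i₀}) {m : ℕ} (hm : Fintype.card ι ≤ m) :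
    (homogeneousSubmodule σ k m).map (LinearMap.prod
      (LinearMap.pi fun i => (aeval (Q i) : MvPolynomial σ k →ₐ[k] k).toLinearMap)
      (dirDeriv (Q i₀) u)) = ⊤ := by
  set E := LinearMap.prod
      (LinearMap.pi fun i => (aeval (Q i) : MvPolynomial σ k →ₐ[k] k).toLinearMap)
      (dirDeriv (Q i₀) u) with hE
  set W := (homogeneousSubmodule σ k m).map E
  have hpad : ∀ (i : ι) (e : ℕ), e ≤ m → ∃ x : MvPolynomial σ k,
      x.IsHomogeneous (m - e) ∧ aeval (Q i) x ≠ 0 := fun i e he => by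
    obtain ⟨j, hj⟩ := Function.ne_iff.1 (hQ0 i)
    exact ⟨X j ^ (m - e), isHomogeneous_X_pow j _, by simpa using pow_ne_zero _ hj⟩
  have hcard : 0 < Fintype.card ι := Fintype.card_pos_iff.2 ⟨i₀⟩
  have hder : ((0 : ι → k), (1 : k)) ∈ W := by
    obtain ⟨g, hg, hg0, hgj⟩ := exists_separating_form hQ i₀
    obtain ⟨x, hx, hx0⟩ := hpad i₀ (Fintype.card ι) hm
    obtain ⟨φ, hφu, hφ⟩ := Submodule.exists_le_ker_of_notMem hu
    have hφ0 : φ (Q i₀) = 0 := hφ (Submodule.mem_span_singleton_self _)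
    -- The factor `φ` vanishes at `Q i₀` but not on `u`, so the product vanishes at every point
    -- while its derivative along `u` does not. Its degree is 1 + (card - 1) + (m - card) = m.
    have hmem : E (ofDual φ * (g * x)) ∈ W := by
      refine Submodule.mem_map_of_mem ?_
      rw [mem_homogeneousSubmodule]
      convert (isHomogeneous_ofDual φ).mul (hg.mul hx) using 1
      omega
    have hval : E (ofDual φ * (g * x)) =
        (φ u * (aeval (Q i₀) g * aeval (Q i₀) x)) • ((0 : ι → k), (1 : k)) := by
      ext j
      · by_cases hj : j = i₀
        · subst hj; simp [-coe_aeval_eq_eval, -aeval_eq_eval, hE, aeval_ofDual, hφ0]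
        · simp [-coe_aeval_eq_eval, -aeval_eq_eval, hE, hgj j hj]
      · simp [-coe_aeval_eq_eval, -aeval_eq_eval, hE, dirDeriv_mul, aeval_ofDual, hφ0, dirDeriv_ofDual]
        ring
    rw [hval] at hmem
    exact (W.smul_mem_iff (mul_ne_zero hφu (mul_ne_zero hg0 hx0))).1 hmem
  have hpt : ∀ i, (Pi.single i (1 : k), (0 : k)) ∈ W := fun i => by
    obtain ⟨g, hg, hg0, hgj⟩ := exists_separating_form hQ i
    obtain ⟨x, hx, hx0⟩ := hpad i (Fintype.card ι - 1) (by omega)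
    have hmem : E (g * x) ∈ W := by
      refine Submodule.mem_map_of_mem ?_
      rw [mem_homogeneousSubmodule]
      convert hg.mul hx using 1
      omega
    -- The uncontrolled derivative of `g * x` is removed with the vector already obtained in `hder`.
    have hval : E (g * x) - dirDeriv (Q i₀) u (g * x) • ((0 : ι → k), (1 : k)) =
        (aeval (Q i) g * aeval (Q i) x) • (Pi.single i (1 : k), (0 : k)) := by
      ext j
      · by_cases hj : j = i
        · subst hj; simp [hE]
        · simp [-coe_aeval_eq_eval, -aeval_eq_eval, hE, hgj j hj, hj]
      · simp [hE]
    have h := W.sub_mem hmem (W.smul_mem (dirDeriv (Q i₀) u (g * x)) hder)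
    rw [hval] at h
    exact (W.smul_mem_iff (mul_ne_zero hg0 hx0)).1 h
  rw [eq_top_iff]
  rintro ⟨a, b⟩ -
  have hab : (a, b) = ∑ i, a i • (Pi.single i (1 : k), (0 : k)) + b • ((0 : ι → k), (1 : k)) := by
    ext j
    · simp [Prod.fst_sum, Finset.sum_apply, Pi.single_apply]
    · simp [Prod.snd_sum]
  rw [hab]
  exact W.add_mem (W.sum_mem fun i _ => W.smul_mem _ (hpt i)) (W.smul_mem _ hder)

end MvPolynomial

/-! ### Growth of the Hilbert function -/

namespace MvPolynomial

variable {σ k : Type*} [Field k]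

/-- The homogeneous part of degree `m` of `k[x] / J`. -/
noncomputable def quotientPart (J : Ideal (MvPolynomial σ k)) (m : ℕ) :
    Submodule k (MvPolynomial σ k ⧸ J) :=
  (homogeneousSubmodule σ k m).map (Ideal.Quotient.mkₐ k J).toLinearMap

instance [Finite σ] (J : Ideal (MvPolynomial σ k)) (m : ℕ) :
    FiniteDimensional k (quotientPart J m) :=
  Module.Finite.iff_fg.2 ((homogeneousSubmodule_fg σ k m).map _)

/-- If `l` is a linear form outside the prime ideal `J`, then linear conditions on forms that
are trivial on `J` and on the multiples of `l` bound the growth of the Hilbert function. -/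
theorem finrank_quotientPart_add_le [Finite σ] {F : Type*} [AddCommGroup F] [Module k F]
    {J : Ideal (MvPolynomial σ k)} (hJ : J.IsPrime) {l : MvPolynomial σ k}
    (hl : l.IsHomogeneous 1) (hlJ : l ∉ J) (E : MvPolynomial σ k →ₗ[k] F)
    (hEJ : ∀ f ∈ J, E f = 0) (hEl : ∀ f, E (l * f) = 0) {m : ℕ}
    (hE : (homogeneousSubmodule σ k (m + 1)).map E = ⊤) :
    Module.finrank k (quotientPart J m) + Module.finrank k F ≤
      Module.finrank k (quotientPart J (m + 1)) := by
  set π := (Ideal.Quotient.mkₐ k J).toLinearMap with hπ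
  have hπker : ∀ f, π f = 0 ↔ f ∈ J := fun f => Ideal.Quotient.eq_zero_iff_mem
  -- As `E` kills `J`, composing it with a linear section of `π` gives the map induced on the
  -- quotient.
  obtain ⟨s, hs⟩ := π.exists_rightInverse_of_surjective
    (LinearMap.range_eq_top.2 (Ideal.Quotient.mkₐ_surjective k J))
  have hEs : ∀ f, E (s (π f)) = E f := fun f => by
    rw [← sub_eq_zero, ← map_sub]
    refine hEJ _ ((hπker _).1 ?_)
    rw [map_sub, sub_eq_zero]
    exact LinearMap.congr_fun hs (π f)
  set g := (E ∘ₗ s).domRestrict (quotientPart J (m + 1)) with hg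
  have hrange : LinearMap.range g = ⊤ := by
    rw [eq_top_iff, ← hE]
    rintro _ ⟨f, hf, rfl⟩
    exact ⟨⟨π f, Submodule.mem_map_of_mem hf⟩, hEs f⟩
  have hrk := g.finrank_range_add_finrank_ker
  rw [hrange, finrank_top] at hrk
  have hinj : Function.Injective (LinearMap.mulLeft k (π l)) := by
    rw [← LinearMap.ker_eq_bot, LinearMap.ker_eq_bot']
    intro x hx
    rw [LinearMap.mulLeft_apply] at hx
    exact (mul_eq_zero.1 hx).resolve_left fun h => hlJ ((hπker l).1 h)
  have hle : (quotientPart J m).map (LinearMap.mulLeft k (π l)) ≤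
      (LinearMap.ker g).map (quotientPart J (m + 1)).subtype := by
    rintro _ ⟨_, ⟨f, hf, rfl⟩, rfl⟩
    have h1 : LinearMap.mulLeft k (π l) (π f) = π (l * f) :=
      (map_mul (Ideal.Quotient.mkₐ k J) l f).symm
    have h2 : π (l * f) ∈ quotientPart J (m + 1) := by
      refine Submodule.mem_map_of_mem ?_
      have h3 := hl.mul hf
      rwa [add_comm] at h3
    refine ⟨⟨π (l * f), h2⟩, ?_, h1.symm⟩
    exact (hEs (l * f)).trans (hEl f)
  have h1 := Submodule.finrank_mono hle
  rw [← (Submodule.equivMapOfInjective _ hinj _).finrank_eq, Submodule.finrank_map_subtype_eq] at h1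
  omega

end MvPolynomial

/-! ### The tangent hyperplane and the degree bound -/

/-- The points of a projective space have representatives, with a prescribed one at one point. -/
theorem Projectivization.exists_representatives {k V : Type*} [Field k] [AddCommGroup V]
    [Module k V] {v : V} (hv : v ≠ 0) :
    ∃ s : ℙ k V → V, (∀ p, s p ≠ 0) ∧ s (mk k v hv) = v ∧
      ∀ p p', p ≠ p' → s p ∉ Submodule.span k {s p'} := by
  classical
  set s : ℙ k V → V := Function.update Projectivization.rep (mk k v hv) v
  have hs : ∀ p, ∃ h : s p ≠ 0, mk k (s p) h = p := fun p => by
    by_cases hp : p = mk k v hv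
    · subst hp; simp [s, hv]
    · simp [s, hp, p.rep_nonzero, p.mk_rep]
  refine ⟨s, fun p => (hs p).1, by simp [s], fun p p' hpp h => hpp ?_⟩
  obtain ⟨a, ha⟩ := Submodule.mem_span_singleton.1 h
  rw [← (hs p).2, ← (hs p').2, mk_eq_mk_iff']
  exact ⟨a, ha⟩

namespace ProjectiveSubscheme

variable {k : Type*} [Field k] {n : ℕ}

theorem finrank_quotientPart_le_hilbertFunction (C : ProjectiveSubscheme k n)
    {J : Ideal (MvPolynomial (Fin (n + 1)) k)} (hJ : C.toIdeal ≤ J) (m : ℕ) :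
    Module.finrank k (quotientPart J m) ≤ C.hilbertFunction m := by
  have h : quotientPart J m =
      (quotientPart C.toIdeal m).map (Ideal.Quotient.factorₐ k hJ).toLinearMap := by
    rw [quotientPart, quotientPart, ← Submodule.map_comp]
    rfl
  rw [h]
  exact Submodule.finrank_map_le _ _

/-- The Hilbert function of a geometrically irreducible subscheme containing all rational points
grows at least linearly, with a slope exceeding the number of points of a rational hyperplane. -/
theorem le_hilbertFunction [Fintype k] (hn : 2 ≤ n) {C : ProjectiveSubscheme k n}
    (hirr : C.GeometricallyIrreducible) (hC : C.points k = Set.univ) :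
    ∃ m₀ : ℕ, ∀ m, (∑ i ∈ Finset.range n, Fintype.card k ^ i + 1) * m ≤
      C.hilbertFunction (m₀ + m) := by
  classical
  obtain ⟨J, hJ, hCJ, hhom, hpt⟩ := exists_isPrime hirr hC
  obtain ⟨u, ⟨i, hi, hui⟩, hu⟩ := exists_tangent_vector (by omega) hJ hhom hpt
  set P : Fin (n + 1) → k := Pi.single 0 1 with hP
  have hP0 : P ≠ 0 := fun h => by simpa [hP] using congrFun h 0
  -- Here n ≥ 2 enters: two vectors cannot span a space of dimension n + 1 ≥ 3.
  have hlt : Submodule.span k {P, u} < ⊤ := by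
    refine lt_of_le_of_ne le_top fun h => ?_
    have h1 := finrank_span_finset_le_card (R := k) ({P, u} : Finset (Fin (n + 1) → k))
    have h2 : ({P, u} : Finset (Fin (n + 1) → k)).card ≤ 2 := Finset.card_le_two
    rw [Finset.coe_pair, Set.finrank, h, finrank_top, Module.finrank_fin_fun] at h1
    omega
  obtain ⟨φ, hφ0, hφ⟩ := Submodule.exists_le_ker_of_lt_top _ hlt
  have hφP : φ P = 0 := hφ (Submodule.subset_span (by simp))
  have hφu : φ u = 0 := hφ (Submodule.subset_span (by simp))
  have hP' : (⟨P, hφP⟩ : LinearMap.ker φ) ≠ 0 := fun h => hP0 (congrArg Subtype.val h)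
  obtain ⟨s, hs0, hsP, hs⟩ := Projectivization.exists_representatives (k := k) hP'
  set p₀ := Projectivization.mk k (⟨P, hφP⟩ : LinearMap.ker φ) hP'
  have : Fintype (ℙ k (LinearMap.ker φ)) := Fintype.ofFinite _
  set Q : ℙ k (LinearMap.ker φ) → Fin (n + 1) → k := fun p => s p with hQ
  have hQP : Q p₀ = P := by rw [hQ]; simp only [hsP]
  have hQ0 : ∀ p, Q p ≠ 0 := fun p h => hs0 p (Subtype.ext h)
  have hQQ : ∀ p p', p ≠ p' → Q p ∉ Submodule.span k {Q p'} := fun p p' hpp h => by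
    obtain ⟨a, ha⟩ := Submodule.mem_span_singleton.1 h
    exact hs p p' hpp (Submodule.mem_span_singleton.2 ⟨a, Subtype.ext ha⟩)
  have huP : u ∉ Submodule.span k {Q p₀} := fun h => by
    obtain ⟨a, ha⟩ := Submodule.mem_span_singleton.1 h
    rw [hQP] at ha
    exact hui (by rw [← ha]; simp [hP, hi])
  have hcard : Fintype.card (ℙ k (LinearMap.ker φ)) =
      ∑ i ∈ Finset.range n, Fintype.card k ^ i := by
    have h1 := Module.Dual.finrank_ker_add_one_of_ne_zero hφ0
    rw [Module.finrank_fin_fun] at h1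
    rw [← Nat.card_eq_fintype_card,
      Projectivization.card_of_finrank k _ (n := n) (by omega), Nat.card_eq_fintype_card]
  have hlJ : ofDual φ ∉ J := fun h => by
    obtain ⟨v, hv⟩ := DFunLike.ne_iff.1 hφ0
    have hv0 : v ≠ 0 := fun h0 => hv (by simp [h0])
    have h1 := hpt v hv0 _ h
    rw [aeval_ofDual] at h1
    exact hv h1
  have hstep : ∀ m, Fintype.card (ℙ k (LinearMap.ker φ)) ≤ m + 1 →
      Module.finrank k (quotientPart J m) + (∑ i ∈ Finset.range n, Fintype.card k ^ i + 1) ≤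
        Module.finrank k (quotientPart J (m + 1)) := fun m hm => by
    have h := finrank_quotientPart_add_le hJ (isHomogeneous_ofDual φ) hlJ _ ?_ ?_
      (map_homogeneousSubmodule_eq_top hQ0 hQQ p₀ huP hm)
    · simpa [hcard] using h
    · intro f hf
      ext p
      · exact hpt _ (hQ0 p) f hf
      · simpa [hQP] using hu f hf
    · intro f
      ext p
      · simp [-coe_aeval_eq_eval, -aeval_eq_eval, aeval_ofDual, hQ]
      -- By the Leibniz rule, both terms vanish since `φ P = 0` and `φ u = 0`: this is the tangency.
      · simp [-coe_aeval_eq_eval, -aeval_eq_eval, dirDeriv_mul, dirDeriv_ofDual, aeval_ofDual, hQP, hφP, hφu]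
  refine ⟨Fintype.card (ℙ k (LinearMap.ker φ)), fun m => le_trans ?_
    (C.finrank_quotientPart_le_hilbertFunction hCJ _)⟩
  induction m with
  | zero => simp
  | succ m ih =>
    have h := hstep (Fintype.card (ℙ k (LinearMap.ker φ)) + m) (by omega)
    rw [mul_add, mul_one, ← add_assoc]
    exact (Nat.add_le_add_right ih _).trans h

/-- The shift by `m₀` costs only `c * m₀ / m` in the normalized Hilbert function, which tends to 0.
-/
theorem le_degree_one_of_le_hilbertFunction (C : ProjectiveSubscheme k n) {c m₀ : ℕ}
    (h : ∀ m, c * m ≤ C.hilbertFunction (m₀ + m)) : ((c : ℝ) : EReal) ≤ C.degree 1 := by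
  have h0 : Tendsto (fun m : ℕ => (c : ℝ) - c * m₀ / m) atTop (nhds c) := by
    simpa using (tendsto_const_div_atTop_nhds_zero_nat ((c : ℝ) * m₀)).const_sub (c : ℝ)
  have h1 : Tendsto (fun m : ℕ => (((c : ℝ) - c * m₀ / m : ℝ) : EReal)) atTop
      (nhds ((c : ℝ) : EReal)) := (continuous_coe_real_ereal.tendsto _).comp h0
  rw [← h1.limsup_eq]
  refine limsup_le_limsup ?_
  filter_upwards [eventually_ge_atTop m₀, eventually_gt_atTop 0] with m hm hm0
  obtain ⟨j, rfl⟩ := Nat.exists_eq_add_of_le hm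
  have hpos : (0 : ℝ) < ((m₀ + j : ℕ) : ℝ) := by exact_mod_cast hm0
  have hj : (c : ℝ) * j ≤ C.hilbertFunction (m₀ + j) := by exact_mod_cast h j
  rw [EReal.coe_le_coe_iff, Nat.factorial_one, Nat.cast_one, one_mul, pow_one, sub_le_iff_le_add,
    ← add_div, le_div_iff₀ hpos]
  push_cast
  linarith

end ProjectiveSubscheme

theorem proposition2p5 {k : Type*} [Field k] [Fintype k] (q : ℕ) (hq : Fintype.card k = q)
    (n : ℕ) (hn : 2 ≤ n) (C : ProjectiveSubscheme k n) (hC : C.IsSmoothSpaceFillingCurve) :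
    ((((q : ℝ) ^ n - 1) / ((q : ℝ) - 1) + 1 : ℝ) : EReal) ≤ C.degree 1 := by
  obtain ⟨m₀, h⟩ := ProjectiveSubscheme.le_hilbertFunction hn hC.geometricallyIrreducible
    hC.points_eq
  have h1 := C.le_degree_one_of_le_hilbertFunction h
  have hq1 : (q : ℝ) ≠ 1 := by
    have := Fintype.one_lt_card (α := k)
    rw [hq] at this
    exact_mod_cast this.ne'
  rw [hq] at h1
  rw [← geom_sum_eq hq1]
  exact_mod_cast h1
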